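/- Let $a\ge 1$ and let $\alpha_1\ge\alpha_2\ge\dots\ge\alpha_a\ge 0$ be real numbers with $\alpha_1+\dots+\alpha_a=1$. Let $\xi_1,\xi_2,\dots$ be independent random variables with values in $\{1,\dots,a\}$ and $P(\xi_n=i)=\alpha_i$ for all $n$ and $i$. Consider the discrete-time TASEP with $a$ particles at integer positions $T_1(n)\ge T_2(n)\ge\dots\ge T_a(n)$, $n=0,1,2,\dots$, defined as follows. Initially $T_1(0)=\dots=T_a(0)=0$. In the step from time $n$ to time $n+1$ only the particle with index $i=\xi_{n+1}$ receives a jumping signal: if $i=1$, or if $i\ge 2$ and $T_i(n)<T_{i-1}(n)$, then $T_i(n+1)=T_i(n)+1$; if $i\ge2$ and $T_i(n)=T_{i-1}(n)$, then the jump is blocked and $T_i(n+1)=T_i(n)$. All other particles keep their positions. (This dynamics preserves the ordering of the particles.) Then, almost surely, $$\lim_{n\to\infty}\frac{T_i(n)}{n}=\alpha_i\qquad\text{for every } i=1,\dots,a.$$ -/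

import Mathlib

/-- One step of the discrete-time TASEP with `a` particles (particle number `i + 1` has index
`i : Fin a`) at positions `T`, when particle `k` receives the jumping signal: `k` moves to the right
by one if it is strictly behind its predecessor `k - 1`, and nothing happens otherwise. The first
particle has no predecessor, so it is never blocked. -/
def tasepStep {a : ℕ} (T : Fin a → ℤ) (k : Fin a) : Fin a → ℤ :=
  if ∀ j : Fin a, (j : ℕ) + 1 = (k : ℕ) → T k < T j then
    Function.update T k (T k + 1)
  else T

/-- The positions at time `n` of the TASEP started with all particles at `0`, when the jumping
signal of the step from time `n` to time `n + 1` is received by the particle `ξ n`. -/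
def tasep {a : ℕ} (ξ : ℕ → Fin a) : ℕ → Fin a → ℤ
  | 0 => fun _ => 0
  | n + 1 => tasepStep (tasep ξ n) (ξ n)

open Filter Topology MeasureTheory ProbabilityTheory

/-! Each particle is a queue fed by its predecessor. Let `N_i` count the signals of particle `i`.
Then `T_i ≤ N_i`, and looking back to the last blocking gives `T_i(n) ≥ T_{i-1}(s) + N_i(n) -
N_i(s)` for some `s ≤ n`. If `T_{i-1}` has slope `α_{i-1} ≥ α_i`, then `T_{i-1}(s) - N_i(s) ≥ -εs -
C`, so `T_i(n) ≥ N_i(n) - εn - C` and `T_i` inherits the slope of `N_i`. Induction on `i` makes this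
a pathwise statement (`tendsto_tasep_div`); randomness enters only through the strong law for `N_i`.
-/

/-- The number of signals received by particle `i` before time `n`. -/
def signalCount {a : ℕ} (ξ : ℕ → Fin a) (i : Fin a) (n : ℕ) : ℝ :=
  ∑ m ∈ Finset.range n, if ξ m = i then 1 else 0

theorem signalCount_succ {a : ℕ} (ξ : ℕ → Fin a) (i : Fin a) (n : ℕ) :
    signalCount ξ i (n + 1) = signalCount ξ i n + if ξ n = i then 1 else 0 :=
  Finset.sum_range_succ _ _

theorem tasep_succ {a : ℕ} (ξ : ℕ → Fin a) (n : ℕ) :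
    tasep ξ (n + 1) = tasepStep (tasep ξ n) (ξ n) := rfl

theorem tasepStep_of_ne {a : ℕ} (T : Fin a → ℤ) {k i : Fin a} (h : k ≠ i) :
    tasepStep T k i = T i := by
  unfold tasepStep
  split_ifs
  · exact Function.update_of_ne h.symm _ _
  · rfl

theorem tasepStep_self {a : ℕ} (T : Fin a → ℤ) (k : Fin a) :
    tasepStep T k k = T k + if ∀ j : Fin a, (j : ℕ) + 1 = (k : ℕ) → T k < T j then 1 else 0 := by
  unfold tasepStep
  split_ifs <;> simp

theorem tasep_le_signalCount {a : ℕ} (ξ : ℕ → Fin a) (i : Fin a) (n : ℕ) :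
    (tasep ξ n i : ℝ) ≤ signalCount ξ i n := by
  induction n with
  | zero => simp [tasep, signalCount]
  | succ n ih =>
    rw [tasep_succ, signalCount_succ]
    by_cases h : ξ n = i
    · subst h
      rw [tasepStep_self, if_pos rfl]
      split_ifs <;> push_cast <;> linarith
    · rw [tasepStep_of_ne _ h, if_neg h]
      linarith

theorem tasep_first {a : ℕ} (ξ : ℕ → Fin a) {i : Fin a} (hi : (i : ℕ) = 0) (n : ℕ) :
    (tasep ξ n i : ℝ) = signalCount ξ i n := by
  induction n with
  | zero => simp [tasep, signalCount]
  | succ n ih =>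
    rw [tasep_succ, signalCount_succ]
    by_cases h : ξ n = i
    · subst h
      rw [tasepStep_self, if_pos (by intro j hj; omega), if_pos rfl]
      push_cast
      linarith
    · rw [tasepStep_of_ne _ h, if_neg h]
      linarith

/-- The lower half of the last-passage formula for a particle in terms of its predecessor. -/
theorem exists_le_tasep {a : ℕ} (ξ : ℕ → Fin a) {i j : Fin a} (hij : (j : ℕ) + 1 = i) (n : ℕ) :
    ∃ s ≤ n, (tasep ξ s j : ℝ) + (signalCount ξ i n - signalCount ξ i s) ≤ tasep ξ n i := by
  induction n with
  | zero => exact ⟨0, le_rfl, by simp [tasep]⟩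
  | succ n ih =>
    obtain ⟨s, hs, h⟩ := ih
    by_cases hk : ξ n = i
    · by_cases hlt : tasep ξ n i < tasep ξ n j
      · refine ⟨s, by omega, ?_⟩
        have hfree : ∀ l : Fin a, (l : ℕ) + 1 = (i : ℕ) → tasep ξ n i < tasep ξ n l := by
          intro l hl
          obtain rfl : l = j := Fin.ext (by omega)
          exact hlt
        rw [tasep_succ, signalCount_succ, if_pos hk, hk, tasepStep_self, if_pos hfree]
        push_cast
        linarith
      -- Blocked: the particle is not behind its predecessor and neither moves, so the present time
      -- serves as `s`, with no signals after it.
      · refine ⟨n + 1, le_rfl, ?_⟩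
        have hne : i ≠ j := by
          rintro rfl
          omega
        have hblocked : ¬ ∀ l : Fin a, (l : ℕ) + 1 = (i : ℕ) → tasep ξ n i < tasep ξ n l :=
          fun hl => hlt (hl j hij)
        rw [tasep_succ, hk, tasepStep_self, if_neg hblocked, tasepStep_of_ne _ hne, sub_self,
          add_zero, add_zero]
        exact_mod_cast not_lt.mp hlt
    · refine ⟨s, by omega, ?_⟩
      rw [tasep_succ, signalCount_succ, if_neg hk, tasepStep_of_ne _ hk, add_zero]
      exact h

/-- A sequence of nonnegative asymptotic slope has an affine minorant of any negative slope. -/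
theorem exists_affine_minorant {d : ℕ → ℝ} {δ ε : ℝ} (hδ : 0 ≤ δ) (hε : 0 < ε)
    (hd : Tendsto (fun n : ℕ => d n / n) atTop (𝓝 δ)) :
    ∃ C, ∀ n : ℕ, -(ε * n) - C ≤ d n := by
  have hev : ∀ᶠ n : ℕ in atTop, 0 ≤ d n + ε * n := by
    filter_upwards [hd.eventually (lt_mem_nhds (show -ε < δ by linarith)), eventually_gt_atTop 0]
      with n hn hpos
    have : (0 : ℝ) < n := by exact_mod_cast hpos
    rw [lt_div_iff₀ this] at hn
    linarith
  obtain ⟨N, hN⟩ := eventually_atTop.mp hev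
  -- This constant dominates each of the finitely many possible deficits before `N`.
  refine ⟨∑ m ∈ Finset.range N, |d m + ε * m|, fun n => ?_⟩
  have hnonneg : 0 ≤ ∑ m ∈ Finset.range N, |d m + ε * m| :=
    Finset.sum_nonneg fun _ _ => abs_nonneg _
  by_cases hn : N ≤ n
  · linarith [hN n hn]
  · have h := Finset.single_le_sum (f := fun m : ℕ => |d m + ε * m|) (fun _ _ => abs_nonneg _)
      (Finset.mem_range.mpr (not_le.mp hn))
    linarith [neg_abs_le (d n + ε * n)]

/-- A departure process that is fed at a rate at least its service rate has its service rate. -/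
theorem tendsto_div_of_le_of_exists_le {t p c : ℕ → ℝ} {γ β : ℝ} (hγβ : γ ≤ β)
    (hp : Tendsto (fun n : ℕ => p n / n) atTop (𝓝 β))
    (hc : Tendsto (fun n : ℕ => c n / n) atTop (𝓝 γ))
    (hle : ∀ n, t n ≤ c n) (hge : ∀ n, ∃ s ≤ n, p s + (c n - c s) ≤ t n) :
    Tendsto (fun n : ℕ => t n / n) atTop (𝓝 γ) := by
  have hd : Tendsto (fun n : ℕ => (p n - c n) / n) atTop (𝓝 (β - γ)) := by
    simpa only [sub_div] using hp.sub hc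
  refine tendsto_order.mpr ⟨fun b hb => ?_, fun b hb => ?_⟩
  -- Half of the gap `γ - b` pays for the slope of the minorant; the other half absorbs `C / n`.
  · have hε : 0 < (γ - b) / 2 := by linarith
    obtain ⟨C, hC⟩ := exists_affine_minorant (sub_nonneg.mpr hγβ) hε hd
    have hlim : Tendsto (fun n : ℕ => c n / n - (γ - b) / 2 - C / n) atTop
        (𝓝 (γ - (γ - b) / 2 - 0)) :=
      (hc.sub_const _).sub (tendsto_const_div_atTop_nhds_zero_nat C)
    filter_upwards [hlim.eventually (lt_mem_nhds (show b < γ - (γ - b) / 2 - 0 by linarith)),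
      eventually_gt_atTop 0] with n hn hpos
    refine hn.trans_le ?_
    have hn0 : (0 : ℝ) < n := by exact_mod_cast hpos
    obtain ⟨s, hs, h⟩ := hge n
    have hsn : (γ - b) / 2 * s ≤ (γ - b) / 2 * n := by gcongr
    rw [le_div_iff₀ hn0, sub_mul, sub_mul, div_mul_cancel₀ _ hn0.ne', div_mul_cancel₀ _ hn0.ne']
    linarith [hC s]
  · filter_upwards [hc.eventually (gt_mem_nhds hb)] with n hn
    exact (div_le_div_of_nonneg_right (hle n) n.cast_nonneg).trans_lt hn

/-- Induction along the particles; monotonicity of `α` ensures that each queue is fed at least as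
fast as it serves. -/
theorem tendsto_tasep_div {a : ℕ} {α : Fin a → ℝ} (hα : Antitone α) (ξ : ℕ → Fin a)
    (hξ : ∀ i, Tendsto (fun n : ℕ => signalCount ξ i n / n) atTop (𝓝 (α i))) (i : Fin a) :
    Tendsto (fun n : ℕ => (tasep ξ n i : ℝ) / n) atTop (𝓝 (α i)) := by
  obtain ⟨k, hk⟩ := i
  induction k with
  | zero => simpa only [tasep_first ξ (i := ⟨0, hk⟩) rfl] using hξ ⟨0, hk⟩
  | succ k ih =>
    exact tendsto_div_of_le_of_exists_le (hα (Fin.mk_le_mk.mpr k.le_succ))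
      (ih (k.lt_succ_self.trans hk)) (hξ _) (tasep_le_signalCount ξ _)
      (exists_le_tasep ξ (j := ⟨k, k.lt_succ_self.trans hk⟩) rfl)

/-- The strong law of large numbers for the number of signals received by a particle. -/
theorem ae_tendsto_signalCount_div {a : ℕ} {α : Fin a → ℝ} (hα : ∀ i, 0 ≤ α i)
    {Ω : Type*} [MeasurableSpace Ω] {μ : Measure Ω} [IsProbabilityMeasure μ]
    {ξ : ℕ → Ω → Fin a} (hmeas : ∀ n, Measurable (ξ n)) (hindep : iIndepFun ξ μ)
    (hlaw : ∀ n i, μ {ω | ξ n ω = i} = ENNReal.ofReal (α i)) (i : Fin a) :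
    ∀ᵐ ω ∂μ, Tendsto (fun n : ℕ => signalCount (fun m => ξ m ω) i n / n) atTop (𝓝 (α i)) := by
  let g : Fin a → ℝ := fun k => if k = i then 1 else 0
  have hg : Measurable g := measurable_of_finite g
  have hmap : ∀ n, μ.map (ξ n) = μ.map (ξ 0) := fun n => by
    refine Measure.ext_of_singleton fun k => ?_
    rw [Measure.map_apply (hmeas n) (measurableSet_singleton k),
      Measure.map_apply (hmeas 0) (measurableSet_singleton k)]
    exact (hlaw n k).trans (hlaw 0 k).symm
  have hident : ∀ n, IdentDistrib (g ∘ ξ n) (g ∘ ξ 0) μ μ := fun n =>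
    IdentDistrib.comp ⟨(hmeas n).aemeasurable, (hmeas 0).aemeasurable, hmap n⟩ hg
  have hset : MeasurableSet {ω | ξ 0 ω = i} := hmeas 0 (measurableSet_singleton i)
  have hind : g ∘ ξ 0 = {ω | ξ 0 ω = i}.indicator (fun _ => (1 : ℝ)) := by
    ext ω
    simp [g, Set.indicator_apply]
  have hint : Integrable (g ∘ ξ 0) μ := by
    rw [hind]
    exact (integrable_const 1).indicator hset
  have hmean : ∫ ω, (g ∘ ξ 0) ω ∂μ = α i := by
    rw [hind, integral_indicator_const _ hset, measureReal_def, hlaw 0 i,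
      ENNReal.toReal_ofReal (hα i), smul_eq_mul, mul_one]
  have hslln := strong_law_ae_real (fun n => g ∘ ξ n) hint
    (fun m n hmn => (hindep.indepFun hmn).comp hg hg) hident
  rw [hmean] at hslln
  exact hslln

theorem mainTheorem5 {a : ℕ} (α : Fin a → ℝ)
    (hα_anti : Antitone α) (hα_nonneg : ∀ i, 0 ≤ α i) (hα_sum : ∑ i, α i = 1)
    {Ω : Type*} [MeasurableSpace Ω] (μ : MeasureTheory.Measure Ω)
    [MeasureTheory.IsProbabilityMeasure μ]
    (ξ : ℕ → Ω → Fin a) (hξ_meas : ∀ n, Measurable (ξ n))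
    (hξ_indep : ProbabilityTheory.iIndepFun ξ μ)
    (hξ_law : ∀ n i, μ {ω | ξ n ω = i} = ENNReal.ofReal (α i)) :
    ∀ᵐ ω ∂μ, ∀ i : Fin a,
      Filter.Tendsto (fun n : ℕ => (tasep (fun m => ξ m ω) n i : ℝ) / (n : ℝ))
        Filter.atTop (nhds (α i)) := by
  filter_upwards [ae_all_iff.mpr
    (ae_tendsto_signalCount_div hα_nonneg hξ_meas hξ_indep hξ_law)] with ω hω
  exact tendsto_tasep_div hα_anti _ hω
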